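/- Let $n\ge 1$, and call a compact convex subset of $\mathbb{R}^n$ with non-empty interior a convex body. Write $|\cdot|$ for Lebesgue measure. For convex bodies $K,L\subset\mathbb{R}^n$ put $$M(K,L)=\sup_{x\in K+L}|K\cap(x-L)|,$$ and for $\theta\in[0,1]$ let $$K+_\theta L=\{x\in K+L:\ |K\cap(x-L)|\ge\theta\,M(K,L)\}$$ be the $\theta$-convolution set of $K$ and $L$, where $K+L$ is the Minkowski sum. Suppose that $K,L\subset\mathbb{R}^n$ are convex bodies satisfying $M(K,L)=|K\cap(-L)|$. Then the following conditions are equivalent: (i) for all $0\le\theta_0\le\theta\le1$, $$(1-\theta^{1/n})(K+_{\theta_0}L)=(1-\theta_0^{1/n})(K+_{\theta}L);$$ (ii) for every $\theta\in[0,1]$, $$(1-\theta^{1/n})(K+L)=K+_\theta L;$$ (iii) $K=-L$, and $K$ is an $n$-simplex (the convex hull of $n+1$ affinely independent points). -/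

import Mathlib

open MeasureTheory
open scoped Pointwise ENNReal

/-- The maximal overlap `M(A,B) = sup_{x ∈ A + B} |A ∩ (x - B)|`, where `|·|` is Lebesgue measure on
`ℝⁿ`; the value `∞` is allowed (it does not occur for bounded sets). -/
noncomputable def maxOverlap {n : ℕ} (A B : Set (EuclideanSpace ℝ (Fin n))) : ℝ≥0∞ :=
  ⨆ x ∈ A + B, volume (A ∩ ({x} - B))

/-- The `θ`-convolution set `A +_θ B = {x ∈ A + B : |A ∩ (x - B)| ≥ θ M(A,B)}`. -/
def thetaConv {n : ℕ} (θ : ℝ) (A B : Set (EuclideanSpace ℝ (Fin n))) :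
    Set (EuclideanSpace ℝ (Fin n)) :=
  {x | x ∈ A + B ∧ ENNReal.ofReal θ * maxOverlap A B ≤ volume (A ∩ ({x} - B))}

/-- `S` is an `n`-simplex in `ℝⁿ`: the convex hull of `n + 1` affinely independent points. -/
def IsFullSimplex {n : ℕ} (S : Set (EuclideanSpace ℝ (Fin n))) : Prop :=
  ∃ s : Affine.Simplex ℝ (EuclideanSpace ℝ (Fin n)) n, S = convexHull ℝ (Set.range s.points)

/-! For (iii) → (ii), barycentric coordinates show that a simplex meets its translate by `x` in a
homothetic copy of itself, with ratio `1 - posSum x`, and that `posSum` is the gauge of `K - K`;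
both sides of (ii) are then `posSum x ≤ 1 - θ^(1/n)`.

For (ii) → (iii), let `a - l` be on the boundary of `K + L`, with `l ∈ -L`. By convexity `K ∩ (t(a -
l) - L)` contains `ta + (1-t)(K ∩ -L)`, of volume `(1-t)^n M`, and (ii) allows no more, so the two
sets coincide. This rigidity is `ExpansionProperty K (-L)`. Applied to chords it gives `K = -L`.
Applied to extreme points it makes them pairwise disjoint in the order of the cone over `K`, as the
atoms of a lattice cone are. A Radon partition then cannot exist, so the extreme points are affinely
independent and `K` is a simplex. -/

/-! ### Antipodal pairs and the inclusion forced by expansion -/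

/-- A pair `a ∈ K`, `l ∈ L` whose difference lies on the relative boundary of `K - L`, seen from
the origin. -/
def AntipodalPair {E : Type*} [AddCommGroup E] [Module ℝ E] (K L : Set E) (a l : E) : Prop :=
  a ∈ K ∧ l ∈ L ∧ ∀ t : ℝ, 1 < t → ∀ k ∈ K, ∀ m ∈ L, k - m ≠ t • (a - l)

/-- Expanding `K` from `a` and `L` from `l` by the same factor does not enlarge `K ∩ L`, for every
antipodal pair `(a, l)`. -/
def ExpansionProperty {E : Type*} [AddCommGroup E] [Module ℝ E] (K L : Set E) : Prop :=
  ∀ a l : E, AntipodalPair K L a l → ∀ t : ℝ, 0 ≤ t → t < 1 → ∀ p : E,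
    (1 - t) • p + t • a ∈ K → (1 - t) • p + t • l ∈ L → p ∈ K ∩ L

theorem AntipodalPair.symm {E : Type*} [AddCommGroup E] [Module ℝ E] {K L : Set E} {a l : E}
    (h : AntipodalPair K L a l) : AntipodalPair L K l a := by
  refine ⟨h.2.1, h.1, fun t ht k hk m hm hkm => h.2.2 t ht m hm k hk ?_⟩
  rw [← neg_sub k m, hkm]
  module

theorem ExpansionProperty.symm {E : Type*} [AddCommGroup E] [Module ℝ E] {K L : Set E}
    (h : ExpansionProperty K L) : ExpansionProperty L K :=
  fun a l hal t ht ht1 p hp hp' => (h l a hal.symm t ht ht1 p hp' hp).symm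

/-- The last point of `L` on a ray starting at an interior point. -/
theorem exists_last_mem_ray {E : Type*} [NormedAddCommGroup E] [NormedSpace ℝ E] {L : Set E}
    (hL : IsCompact L) {q d : E} (hq : q ∈ L) (hd : d ≠ 0) :
    ∃ t : ℝ, 0 ≤ t ∧ q + t • d ∈ L ∧ ∀ s > t, q + s • d ∉ L := by
  have hcont : Continuous fun t : ℝ => q + t • d := by fun_prop
  have hemb : Topology.IsClosedEmbedding fun t : ℝ => q + t • d :=
    (Homeomorph.addLeft q).isClosedEmbedding.comp
      (isClosedEmbedding_smul_left hd)
  have hc : IsCompact ((fun t : ℝ => q + t • d) ⁻¹' L) := hemb.isCompact_preimage hL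
  obtain ⟨t, ht, hmax⟩ := hc.exists_isGreatest ⟨0, by simpa using hq⟩
  refine ⟨t, hmax (by simpa using hq), ht, fun s hs hmem => ?_⟩
  exact absurd (hmax hmem) (not_le.mpr hs)

/-- Let `u` support `L` from above at `l`, and let `a` minimise `u` on `K`. Then `u (a - l)` is the
least value of `u` on `K - L`, and it is negative because of `q`; a multiple by `t > 1` would go
lower. -/
theorem exists_antipodalPair_of_notMem_interior {E : Type*} [NormedAddCommGroup E]
    [NormedSpace ℝ E] {K L : Set E} (hK : IsCompact K) (hLc : Convex ℝ L)
    {q l : E} (hqK : q ∈ K) (hqL : q ∈ interior L) (hl : l ∈ L) (hl' : l ∉ interior L) :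
    ∃ a, AntipodalPair K L a l := by
  obtain ⟨u, hu⟩ := geometric_hahn_banach_open_point hLc.interior isOpen_interior hl'
  have hu' : ∀ y ∈ L, u y ≤ u l := by
    have hcl : L ⊆ closure (interior L) := by
      rw [hLc.closure_interior_eq_closure_of_nonempty_interior ⟨q, hqL⟩]
      exact subset_closure
    intro y hy
    exact closure_minimal (fun z hz => (hu z hz).le)
      (isClosed_le u.continuous continuous_const) (hcl hy)
  obtain ⟨a, ha, hmin⟩ := hK.exists_isMinOn ⟨q, hqK⟩ u.continuous.continuousOn
  refine ⟨a, ha, hl, fun t ht k hk m hm hkm => ?_⟩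
  have h1 := congrArg u hkm
  simp only [map_sub, map_smul, smul_eq_mul] at h1
  have h2 := hu' m hm
  have h3 : u a ≤ u k := hmin hk
  have h4 : u a ≤ u q := hmin hqK
  have h5 := hu q hqL
  nlinarith

theorem ExpansionProperty.subset {E : Type*} [NormedAddCommGroup E] [NormedSpace ℝ E]
    {K L : Set E} (h : ExpansionProperty K L) (hK : IsCompact K) (hKc : Convex ℝ K)
    (hL : IsCompact L) (hLc : Convex ℝ L) (hint : (interior (K ∩ L)).Nonempty) : K ⊆ L := by
  intro p hp
  by_contra hpL
  obtain ⟨q, hq⟩ := hint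
  have hqK : q ∈ K := (interior_subset hq).1
  have hqL : q ∈ interior L := interior_mono Set.inter_subset_right hq
  have hpq : p - q ≠ 0 := fun h0 => hpL (sub_eq_zero.1 h0 ▸ interior_subset hqL)
  obtain ⟨t₀, ht₀, hl, hlast⟩ := exists_last_mem_ray hL (interior_subset hqL)
    (d := -(p - q)) (neg_ne_zero.2 hpq)
  obtain ⟨t₁, ht₁, hm, hlast₁⟩ := exists_last_mem_ray hL (interior_subset hqL) hpq
  have key : ∀ d : E, ∀ t : ℝ, q + t • d ∈ interior L → ∃ s > t, q + s • d ∈ L := by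
    intro d t hd
    have hc : Continuous fun s : ℝ => q + s • d := by fun_prop
    have ho : ∀ᶠ s in nhds t, q + s • d ∈ interior L :=
      hc.continuousAt.eventually_mem (isOpen_interior.mem_nhds hd)
    obtain ⟨ε, hε, hb⟩ := Metric.eventually_nhds_iff.1 ho
    refine ⟨t + ε / 2, by linarith, interior_subset (hb ?_)⟩
    simp [abs_of_pos hε]
    linarith
  have hl' : q + t₀ • -(p - q) ∉ interior L := fun hc => by
    obtain ⟨s, hs, hs'⟩ := key _ _ hc
    exact hlast s hs hs'
  have ht₁pos : 0 < t₁ := by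
    obtain ⟨s, hs, hs'⟩ := key (p - q) 0 (by simpa using hqL)
    by_contra hneg
    exact hlast₁ s (by linarith) hs'
  have ht₁lt : t₁ < 1 := by
    by_contra hge
    apply hpL
    have := hLc (interior_subset hqL) hm (a := 1 - 1 / t₁) (b := 1 / t₁)
      (by rw [sub_nonneg, div_le_one ht₁pos]; linarith) (by positivity) (by ring)
    convert this using 1
    match_scalars <;> field_simp
    ring
  obtain ⟨a, hal⟩ := exists_antipodalPair_of_notMem_interior hK hLc hqK hqL hl hl'
  have hpos : 0 < 1 + t₀ := by linarith
  -- The line through `p` and `q` meets `L` in a chord from `l` to `m = q + t₁(p - q)`, short of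
  -- `p`. The parameter is the one for which `(1-t)p + tl = m`.
  refine hpL (h a _ hal ((1 - t₁) / (1 + t₀)) (by apply div_nonneg <;> linarith) ?_ p ?_ ?_).2
  · rw [div_lt_one hpos]; linarith
  · refine hKc hp hal.1 ?_ (by apply div_nonneg <;> linarith) (by ring)
    rw [sub_nonneg, div_le_one hpos]; linarith
  · convert hm using 1
    match_scalars <;> field_simp <;> ring

/-! ### The cone order and the independence of extreme points -/

/-- The vectors of the cone over `K × {1}`. -/
def coneOver {E : Type*} [AddCommGroup E] [Module ℝ E] (K : Set E) : Set (E × ℝ) :=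
  {z | 0 ≤ z.2 ∧ z.1 ∈ z.2 • K}

theorem coneOver_add {E : Type*} [AddCommGroup E] [Module ℝ E] {K : Set E} (hK : Convex ℝ K)
    {y z : E × ℝ} (hy : y ∈ coneOver K) (hz : z ∈ coneOver K) : y + z ∈ coneOver K := by
  refine ⟨add_nonneg hy.1 hz.1, ?_⟩
  rw [Prod.snd_add, hK.add_smul hy.1 hz.1]
  exact Set.add_mem_add hy.2 hz.2

theorem smul_mem_coneOver {E : Type*} [AddCommGroup E] [Module ℝ E] {K : Set E} {p : E}
    (hp : p ∈ K) {α : ℝ} (hα : 0 ≤ α) : α • (p, (1 : ℝ)) ∈ coneOver K := by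
  refine ⟨by simpa using hα, ?_⟩
  simpa using Set.smul_mem_smul_set (a := α) hp

/-- If the ray through `e - f` left `K - K` later, at `T(e - f) = a - l` with `T > 1`, then `e` and
`f` would divide the segments from a common `p` to `a` and to `l` in the same ratio. Expansion puts
`p` in `K`, and extremality forces `a = e`, `l = f`, hence `T = 1`. -/
theorem ExpansionProperty.antipodalPair_of_extreme {E : Type*} [NormedAddCommGroup E]
    [NormedSpace ℝ E] {K : Set E} (h : ExpansionProperty K K) (hK : IsCompact K)
    {e f : E} (he : e ∈ K.extremePoints ℝ) (hf : f ∈ K.extremePoints ℝ) (hef : e ≠ f) :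
    AntipodalPair K K e f := by
  have hef' : e - f ≠ 0 := sub_ne_zero.2 hef
  obtain ⟨T, hT, hmem, hlast⟩ := exists_last_mem_ray (L := K - K) (sub_eq_add_neg K K ▸ hK.add hK.neg) (q := 0) (d := e - f)
    ⟨e, he.1, e, he.1, sub_self e⟩ hef'
  have hT1 : 1 ≤ T := by
    by_contra hlt
    exact hlast 1 (not_le.1 hlt) ⟨e, he.1, f, hf.1, by simp⟩
  rcases hT1.eq_or_lt with rfl | hT1
  · exact ⟨he.1, hf.1, fun t ht k hk m hm hkm => hlast t ht ⟨k, hk, m, hm, by simpa using hkm⟩⟩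
  exfalso
  obtain ⟨a, ha, l, hl, hal⟩ := hmem
  simp only [zero_add] at hal
  have hpair : AntipodalPair K K a l := by
    refine ⟨ha, hl, fun t ht k hk m hm hkm => hlast (t * T) (by nlinarith) ⟨k, hk, m, hm, ?_⟩⟩
    simp only [zero_add]
    rw [hkm, hal, smul_smul]
  have hT0 : 0 < T := by linarith
  have hT1' : 0 < T - 1 := by linarith
  set r : ℝ := T⁻¹ with hr
  have hr0 : 0 < r := inv_pos.2 hT0
  have hr1 : r < 1 := inv_lt_one_of_one_lt₀ hT1
  have hr1' : 1 - r ≠ 0 := by linarith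
  have hfe : f = e - r • (a - l) := by
    rw [hal, smul_smul, hr, inv_mul_cancel₀ hT0.ne']
    module
  have hpe : (1 - r) • ((1 - r)⁻¹ • (e - r • a)) + r • a = e := by
    rw [smul_smul, mul_inv_cancel₀ hr1']; module
  have hpf : (1 - r) • ((1 - r)⁻¹ • (e - r • a)) + r • l = f := by
    rw [smul_smul, mul_inv_cancel₀ hr1', hfe]; module
  have hp := (h a l hpair r hr0.le hr1 _ (hpe ▸ he.1) (hpf ▸ hf.1)).1
  have hae : a = e := he.2 ha hp ⟨r, 1 - r, hr0, by linarith, by ring, by rw [add_comm]; exact hpe⟩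
  have hlf : l = f := hf.2 hl hp ⟨r, 1 - r, hr0, by linarith, by ring, by rw [add_comm]; exact hpf⟩
  rw [hae, hlf] at hal
  have : (T - 1) • (e - f) = 0 := by rw [sub_smul, ← hal, one_smul, sub_self]
  exact (smul_ne_zero hT1'.ne' hef') this

/-- With `z = y - αe - βf` this says that `y ≥ αe` and `y ≥ βf` imply `y ≥ αe + βf` in the cone
order. The height `s` of `z` decides: `s < 0` contradicts antipodality, `s = 0` forces `v = 0` by
extremality, and `s > 0` is the expansion property at `v / s`. -/
theorem ExpansionProperty.mem_coneOver {E : Type*} [NormedAddCommGroup E]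
    [NormedSpace ℝ E] {K : Set E} (h : ExpansionProperty K K) (hK : IsCompact K)
    (hKc : Convex ℝ K) {e f : E} (he : e ∈ K.extremePoints ℝ) (hf : f ∈ K.extremePoints ℝ)
    (hef : e ≠ f) {α β : ℝ} (hα : 0 ≤ α) {z : E × ℝ}
    (hze : z + α • (e, (1 : ℝ)) ∈ coneOver K) (hzf : z + β • (f, (1 : ℝ)) ∈ coneOver K) :
    z ∈ coneOver K := by
  have hpair := h.antipodalPair_of_extreme hK he hf hef
  obtain ⟨v, s⟩ := z
  -- A common coefficient for `e` and `f`; the `+ 1` makes `γ` and `s + γ` strictly positive.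
  set γ : ℝ := max α β + 1 with hγ
  have hγα : 0 ≤ γ - α := by have := le_max_left α β; linarith
  have hγβ : 0 ≤ γ - β := by have := le_max_right α β; linarith
  have hγ0 : 0 < γ := by have := le_max_left α β; linarith
  have hsα : 0 ≤ s + α := by simpa using hze.1
  have hsγ : 0 < s + γ := by have := le_max_left α β; linarith
  have h1 : (v, s) + γ • (e, (1 : ℝ)) ∈ coneOver K := by
    have := coneOver_add hKc hze (smul_mem_coneOver he.1 hγα)
    convert this using 1
    module
  have h2 : (v, s) + γ • (f, (1 : ℝ)) ∈ coneOver K := by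
    have := coneOver_add hKc hzf (smul_mem_coneOver hf.1 hγβ)
    convert this using 1
    module
  have k1 : v + γ • e ∈ (s + γ) • K := by simpa using h1.2
  have k2 : v + γ • f ∈ (s + γ) • K := by simpa using h2.2
  rw [Set.mem_smul_set_iff_inv_smul_mem₀ hsγ.ne'] at k1 k2
  rcases lt_trichotomy s 0 with hs | hs | hs
  · refine absurd ?_ (hpair.2.2 (γ / (s + γ)) ?_ _ k1 _ k2)
    · match_scalars <;> field_simp
      ring
    · rw [one_lt_div hsγ]; linarith
  · subst hs
    have hc : γ⁻¹ • v = 0 := by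
      have e1 : (0 + γ)⁻¹ • (v + γ • e) = e + γ⁻¹ • v := by
        match_scalars <;> field_simp <;> ring
      have e2 : (0 + γ)⁻¹ • (v + γ • f) = f + γ⁻¹ • v := by
        match_scalars <;> field_simp <;> ring
      rw [e1] at k1
      rw [e2] at k2
      -- Translating both points by `v / γ` keeps their difference, so the pair stays antipodal.
      -- Expansion with `t = 1/2` then makes `e` the midpoint of `e ± v / γ`, both in `K`.
      have hpair' : AntipodalPair K K (e + γ⁻¹ • v) (f + γ⁻¹ • v) := by
        refine ⟨k1, k2, fun t ht k hk m hm hkm => hpair.2.2 t ht k hk m hm ?_⟩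
        rw [hkm]; module
      have hm := (h _ _ hpair' (1 / 2) (by norm_num) (by norm_num) (e - γ⁻¹ • v) (by
        convert he.1 using 1; module) (by
        convert hKc he.1 hf.1 (a := 1 / 2) (b := 1 / 2) (by norm_num) (by norm_num)
          (by norm_num) using 1; module)).1
      have := he.2 k1 hm ⟨1 / 2, 1 / 2, by norm_num, by norm_num, by norm_num, by module⟩
      simpa using this
    have hv : v = 0 := (smul_eq_zero.1 hc).resolve_left (inv_ne_zero hγ0.ne')
    refine ⟨le_rfl, ?_⟩
    rw [hv]
    exact ⟨e, he.1, by simp⟩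
  · refine ⟨hs.le, ?_⟩
    simp only
    rw [Set.mem_smul_set_iff_inv_smul_mem₀ hs.ne']
    refine (h e f hpair (γ / (s + γ)) (by positivity) ?_ (s⁻¹ • v) ?_ ?_).1
    · rw [div_lt_one hsγ]; linarith
    · convert k1 using 1
      match_scalars <;> field_simp
      ring
    · convert k2 using 1
      match_scalars <;> field_simp
      ring

/-- The points disjoint from `e` in the order given by the cone over `K`. -/
def disjointPoints {E : Type*} [AddCommGroup E] [Module ℝ E] (K : Set E) (e : E) : Set E :=
  {p | p ∈ K ∧ ∀ α β : ℝ, 0 ≤ α → 0 ≤ β → ∀ y : E × ℝ, y - α • (e, (1 : ℝ)) ∈ coneOver K →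
    y - β • (p, (1 : ℝ)) ∈ coneOver K →
    y - α • (e, (1 : ℝ)) - β • (p, (1 : ℝ)) ∈ coneOver K}

/-- The two summands of `β(bp + cq)` are removed one after the other: disjointness from `p` keeps
`αe` below `y - βbp`, to which disjointness from `q` applies. -/
theorem convex_disjointPoints {E : Type*} [AddCommGroup E] [Module ℝ E] {K : Set E}
    (hK : Convex ℝ K) (e : E) : Convex ℝ (disjointPoints K e) := by
  intro p hp q hq b c hb hc hbc
  refine ⟨hK hp.1 hq.1 hb hc hbc, fun α β hα hβ y hye hy => ?_⟩
  have hsplit : β • (b • p + c • q, (1 : ℝ)) =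
      (β * b) • (p, (1 : ℝ)) + (β * c) • (q, (1 : ℝ)) := by
    ext
    · simp [smul_smul]
    · simp [← mul_add, hbc]
  rw [hsplit] at hy ⊢
  have h1 : y - α • (e, (1 : ℝ)) - (β * b) • (p, (1 : ℝ)) ∈ coneOver K := by
    refine hp.2 α (β * b) hα (mul_nonneg hβ hb) y hye ?_
    convert coneOver_add hK hy (smul_mem_coneOver hq.1 (mul_nonneg hβ hc)) using 1
    module
  convert hq.2 α (β * c) hα (mul_nonneg hβ hc) (y - (β * b) • (p, (1 : ℝ)))
    (by convert h1 using 1; module) (by convert hy using 1; module) using 1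
  module

/-- The point dominates both `αe` and itself, so disjointness would put `-αe`, of negative height,
in the cone. -/
theorem notMem_disjointPoints {E : Type*} [AddCommGroup E] [Module ℝ E] {K : Set E}
    {e k : E} (hk : k ∈ K) {α : ℝ} (hα : 0 < α) (hα1 : α ≤ 1) :
    α • e + (1 - α) • k ∉ disjointPoints K e := by
  intro hp
  have h0 : (α • e + (1 - α) • k, (1 : ℝ)) - α • (e, (1 : ℝ)) ∈ coneOver K := by
    convert smul_mem_coneOver hk (sub_nonneg.2 hα1) using 1
    ext <;> simp
  have h1 : (α • e + (1 - α) • k, (1 : ℝ)) - (1 : ℝ) • (α • e + (1 - α) • k, (1 : ℝ)) ∈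
      coneOver K := by
    convert smul_mem_coneOver hk le_rfl using 1
    ext <;> simp
  have h2 := (hp.2 α 1 hα.le zero_le_one _ h0 h1).1
  simp at h2
  linarith

/-- A Radon point has some `e` from one part with positive weight. It also lies in the hull of the
other part, all of whose points are disjoint from `e`, so by convexity it is itself disjoint from
`e`, which is impossible. -/
theorem ExpansionProperty.affineIndependent_extremePoints {E : Type*} [NormedAddCommGroup E]
    [NormedSpace ℝ E] {K : Set E} (h : ExpansionProperty K K) (hK : IsCompact K)
    (hKc : Convex ℝ K) : AffineIndependent ℝ ((↑) : K.extremePoints ℝ → E) := by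
  by_contra hdep
  obtain ⟨I, x, hxI, hxJ⟩ := Convex.radon_partition hdep
  obtain ⟨ι, _, w, z, hw, hw1, hz, rfl⟩ := mem_convexHull_iff_exists_fintype.1 hxI
  have hzK : ∀ i, z i ∈ K := fun i => by
    obtain ⟨y, -, hy⟩ := hz i
    exact hy ▸ y.2.1
  obtain ⟨i, hi⟩ : ∃ i, 0 < w i := by
    by_contra! hle
    have : ∑ i, w i ≤ 0 := Finset.sum_nonpos fun i _ => hle i
    linarith
  obtain ⟨e, heI, hei⟩ := hz i
  have hmem : ∑ i, w i • z i ∈ disjointPoints K (z i) := by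
    refine convexHull_min ?_ (convex_disjointPoints hKc (z i)) hxJ
    rintro _ ⟨f, hf, rfl⟩
    have hne : z i ≠ f := fun hc => hf (Subtype.ext (hei.trans hc) ▸ heI)
    refine ⟨f.2.1, fun α β hα _ y hye hyf => ?_⟩
    refine h.mem_coneOver (β := β) hK hKc (hei ▸ e.2) f.2 hne hα ?_ ?_
    · convert hyf using 1; module
    · convert hye using 1; module
  have hwi : w i ≤ 1 := hw1 ▸ Finset.single_le_sum (fun j _ => hw j) (Finset.mem_univ i)
  classical
  have hsum : ∑ j, w j • z j = w i • z i + ∑ j ∈ Finset.univ.erase i, w j • z j :=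
    (Finset.add_sum_erase _ _ (Finset.mem_univ i)).symm
  have hsum1 : ∑ j ∈ Finset.univ.erase i, w j = 1 - w i := by
    rw [← hw1, ← Finset.add_sum_erase _ _ (Finset.mem_univ i)]; ring
  have hrest : ∑ j ∈ Finset.univ.erase i, w j • z j ∈ (1 - w i) • K := by
    rcases hwi.eq_or_lt with h1 | h1
    · have hz0 : ∀ j ∈ Finset.univ.erase i, w j = 0 :=
        (Finset.sum_eq_zero_iff_of_nonneg fun j _ => hw j).1 (by rw [hsum1, h1, sub_self])
      rw [Finset.sum_eq_zero fun j hj => by rw [hz0 j hj, zero_smul], h1]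
      exact ⟨z i, hzK i, by simp⟩
    · have hpos : 0 < 1 - w i := by linarith
      rw [Set.mem_smul_set_iff_inv_smul_mem₀ hpos.ne', ← hsum1]
      exact hKc.centerMass_mem (fun j _ => hw j) (hsum1 ▸ hpos) fun j _ => hzK j
  obtain ⟨k, hk, hk'⟩ := hrest
  rw [hsum, ← hk'] at hmem
  exact notMem_disjointPoints hk hi hwi hmem

theorem ExpansionProperty.isFullSimplex {n : ℕ} {K : Set (EuclideanSpace ℝ (Fin n))}
    (h : ExpansionProperty K K) (hK : IsCompact K) (hKc : Convex ℝ K)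
    (hint : (interior K).Nonempty) : IsFullSimplex K := by
  have hind := h.affineIndependent_extremePoints hK hKc
  have hfin : (K.extremePoints ℝ).Finite := finite_set_of_fin_dim_affineIndependent ℝ hind
  have hKeq : convexHull ℝ (K.extremePoints ℝ) = K := by
    rw [← (hfin.isClosed_convexHull (𝕜 := ℝ)).closure_eq]
    exact closure_convexHull_extremePoints hK hKc
  have : Fintype (K.extremePoints ℝ) := hfin.fintype
  have hspan : affineSpan ℝ (Set.range ((↑) : K.extremePoints ℝ → EuclideanSpace ℝ (Fin n))) =
      ⊤ := by
    rw [Subtype.range_coe, ← interior_convexHull_nonempty_iff_affineSpan_eq_top, hKeq]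
    exact hint
  have hcard := hind.affineSpan_eq_top_iff_card_eq_finrank_add_one.1 hspan
  rw [finrank_euclideanSpace_fin] at hcard
  let φ := (Fintype.equivFinOfCardEq hcard).symm
  refine ⟨⟨fun i => φ i, hind.comp_embedding φ.toEmbedding⟩, ?_⟩
  have : Set.range (fun i => (φ i : EuclideanSpace ℝ (Fin n))) = K.extremePoints ℝ := by
    exact (φ.surjective.range_comp Subtype.val).trans Subtype.range_coe
  simp only [this, hKeq]

/-! ### Overlap volumes and the derivation of the expansion property -/

theorem Convex.interior_nonempty_of_volume_ne_zero {n : ℕ} {A : Set (EuclideanSpace ℝ (Fin n))}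
    (hA : Convex ℝ A) (h : volume A ≠ 0) : (interior A).Nonempty := by
  by_contra hne
  rw [Set.not_nonempty_iff_eq_empty] at hne
  refine h (measure_mono_null ?_ (hA.addHaar_frontier volume))
  rw [frontier, hne, Set.sdiff_empty]
  exact subset_closure

/-- Serves the equality case: a point of `B` off the closed set `A` is a limit of interior points of
`B`, so `B \ A` contains a nonempty open set. -/
theorem Convex.volume_lt_volume {n : ℕ} {A B : Set (EuclideanSpace ℝ (Fin n))}
    (hA : IsClosed A) (hA0 : volume A ≠ 0) (hA1 : volume A ≠ ∞) (hB : Convex ℝ B)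
    (hAB : A ⊆ B) (hBA : ¬ B ⊆ A) : volume A < volume B := by
  obtain ⟨w, hwB, hwA⟩ := Set.not_subset.1 hBA
  have hBint : (interior B).Nonempty := hB.interior_nonempty_of_volume_ne_zero fun h0 =>
    hA0 (measure_mono_null hAB h0)
  have hw : w ∈ closure (interior B) := by
    rw [hB.closure_interior_eq_closure_of_nonempty_interior hBint]
    exact subset_closure hwB
  have hne : (Aᶜ ∩ interior B).Nonempty := mem_closure_iff.1 hw _ hA.isOpen_compl hwA
  have hpos : 0 < volume (Aᶜ ∩ interior B) :=
    (hA.isOpen_compl.inter isOpen_interior).measure_pos volume hne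
  have hsub : Aᶜ ∩ interior B ⊆ B \ A := fun z hz => ⟨interior_subset hz.2, hz.1⟩
  calc volume A < volume A + volume (B \ A) :=
        ENNReal.lt_add_right hA1 (hpos.trans_le (measure_mono hsub)).ne'
    _ = volume B := by
        rw [← measure_inter_add_sdiff B hA.measurableSet, Set.inter_eq_self_of_subset_right hAB]

theorem mem_singleton_sub_iff {E : Type*} [AddCommGroup E] {x y : E} {L : Set E} :
    y ∈ ({x} - L : Set E) ↔ x - y ∈ L := by
  constructor
  · rintro ⟨_, rfl, m, hm, rfl⟩
    simpa using hm
  · exact fun h => ⟨x, rfl, _, h, by simp⟩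

theorem volume_le_maxOverlap {n : ℕ} {K L : Set (EuclideanSpace ℝ (Fin n))}
    {x : EuclideanSpace ℝ (Fin n)} (hx : x ∈ K + L) :
    volume (K ∩ ({x} - L)) ≤ maxOverlap K L :=
  le_iSup₂_of_le x hx le_rfl

theorem maxOverlap_ne_zero {n : ℕ} {K L : Set (EuclideanSpace ℝ (Fin n))}
    (hK : (interior K).Nonempty) (hL : (interior L).Nonempty) : maxOverlap K L ≠ 0 := by
  obtain ⟨k, hk⟩ := hK
  obtain ⟨l, hl⟩ := hL
  have hopen : IsOpen (interior K ∩ (fun y => k + l - y) ⁻¹' interior L) :=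
    isOpen_interior.inter (isOpen_interior.preimage (by fun_prop))
  have hpos := hopen.measure_pos volume ⟨k, hk, by simpa using hl⟩
  have hle : volume (K ∩ ({k + l} - L)) ≤ maxOverlap K L :=
    volume_le_maxOverlap ⟨k, interior_subset hk, l, interior_subset hl, rfl⟩
  refine (hpos.trans_le (le_trans (measure_mono fun y hy => ?_) hle)).ne'
  exact ⟨interior_subset hy.1, mem_singleton_sub_iff.2 (interior_subset hy.2)⟩

theorem volume_vadd_smul {n : ℕ} (c : EuclideanSpace ℝ (Fin n)) {r : ℝ} (hr : 0 ≤ r)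
    (A : Set (EuclideanSpace ℝ (Fin n))) :
    volume (c +ᵥ r • A) = ENNReal.ofReal (r ^ n) * volume A := by
  rw [measure_vadd, Measure.addHaar_smul, finrank_euclideanSpace_fin, abs_of_nonneg (by positivity)]

/-- The overlap decays along rays at least as fast as the `θ`-convolution sets shrink. -/
theorem volume_inter_le_of_thetaConv {n : ℕ} (hn : n ≠ 0)
    {K L : Set (EuclideanSpace ℝ (Fin n))} (hM0 : maxOverlap K L ≠ 0) (hM1 : maxOverlap K L ≠ ∞)
    (h : ∀ θ : ℝ, 0 ≤ θ → θ ≤ 1 → (1 - θ ^ (1 / (n : ℝ))) • (K + L) = thetaConv θ K L)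
    {a l : EuclideanSpace ℝ (Fin n)} (hal : AntipodalPair K (-L) a l) {t : ℝ}
    (ht1 : t < 1) (hx : t • (a - l) ∈ K + L) :
    volume (K ∩ ({t • (a - l)} - L)) ≤ ENNReal.ofReal ((1 - t) ^ n) * maxOverlap K L := by
  by_contra! hlt
  set v := volume (K ∩ ({t • (a - l)} - L)) with hv
  have hvM : v ≤ maxOverlap K L := volume_le_maxOverlap hx
  have hq1 : v / maxOverlap K L ≤ 1 := ENNReal.div_le_of_le_mul (by simpa using hvM)
  have hqtop : v / maxOverlap K L ≠ ∞ := ne_top_of_le_ne_top ENNReal.one_ne_top hq1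
  -- The exact level of the point `t(a - l)`. By `h` this point lies in `(1 - θ^(1/n))(K + L)`,
  -- whose factor is less than `t`, against antipodality.
  set θ := (v / maxOverlap K L).toReal with hθ
  have hθ0 : 0 ≤ θ := ENNReal.toReal_nonneg
  have hθ1 : θ ≤ 1 := ENNReal.toReal_le_of_le_ofReal zero_le_one (by simpa using hq1)
  have hθv : ENNReal.ofReal θ * maxOverlap K L = v := by
    rw [hθ, ENNReal.ofReal_toReal hqtop, ENNReal.div_mul_cancel hM0 hM1]
  have ht1' : 0 ≤ 1 - t := by linarith
  have hθlt : (1 - t) ^ n < θ := by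
    rw [← hθv] at hlt
    by_contra! hle
    exact absurd (mul_le_mul_left (ENNReal.ofReal_le_ofReal hle) _) (not_le.2 hlt)
  have hroot : 1 - t < θ ^ (1 / (n : ℝ)) := by
    rw [one_div, ← Real.pow_rpow_inv_natCast ht1' hn]
    exact Real.rpow_lt_rpow (by positivity) hθlt (by positivity)
  have hroot1 : θ ^ (1 / (n : ℝ)) ≤ 1 := Real.rpow_le_one hθ0 hθ1 (by positivity)
  have hmem : t • (a - l) ∈ thetaConv θ K L := ⟨hx, hθv.le⟩
  rw [← h θ hθ0 hθ1] at hmem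
  obtain ⟨_, ⟨k, hk, m, hm, rfl⟩, hkm⟩ := hmem
  simp only at hkm
  set ρ := 1 - θ ^ (1 / (n : ℝ)) with hρ
  have hm' : -m ∈ -L := by simpa using hm
  rcases (show 0 ≤ ρ by linarith).eq_or_lt with h0 | h0
  · rw [← h0, zero_smul, eq_comm, smul_eq_zero] at hkm
    have hal0 : a - l = 0 := hkm.resolve_left (by linarith)
    exact hal.2.2 2 (by norm_num) a hal.1 l hal.2.1 (by rw [hal0, smul_zero])
  · refine hal.2.2 (t / ρ) ?_ k hk (-m) hm' ?_
    · rw [one_lt_div h0]; linarith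
    · rw [div_eq_inv_mul, mul_smul, ← hkm, smul_smul, inv_mul_cancel₀ h0.ne']
      module

theorem expansionProperty_of_thetaConv {n : ℕ} (hn : n ≠ 0)
    {K L : Set (EuclideanSpace ℝ (Fin n))} (hK : IsCompact K) (hKc : Convex ℝ K)
    (hL : IsCompact L) (hLc : Convex ℝ L) (hM0 : maxOverlap K L ≠ 0)
    (hM : maxOverlap K L = volume (K ∩ -L))
    (h : ∀ θ : ℝ, 0 ≤ θ → θ ≤ 1 → (1 - θ ^ (1 / (n : ℝ))) • (K + L) = thetaConv θ K L) :
    ExpansionProperty K (-L) := by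
  have hA : IsCompact (K ∩ -L) := hK.inter_right hL.neg.isClosed
  have hM1 : maxOverlap K L ≠ ∞ := hM ▸ hA.measure_lt_top.ne
  intro a l hal t ht ht1 p hpK hpL
  have ht1' : 0 < 1 - t := by linarith
  obtain ⟨q, hqK, hqL⟩ : (K ∩ -L).Nonempty :=
    nonempty_of_measure_ne_zero (μ := volume) (hM ▸ hM0)
  have hx : t • (a - l) ∈ K + L := by
    refine ⟨(1 - t) • q + t • a, hKc hqK hal.1 ht1'.le ht (by ring),
      (1 - t) • -q + t • -l, hLc hqL hal.2.1 ht1'.le ht (by ring), ?_⟩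
    simp only
    module
  have hle := volume_inter_le_of_thetaConv hn hM0 hM1 h hal ht1 hx
  have hvol := volume_vadd_smul (t • a) ht1'.le (K ∩ -L)
  rw [hM, ← hvol] at hle
  have hpos : ENNReal.ofReal ((1 - t) ^ n) ≠ 0 := by
    rw [Ne, ENNReal.ofReal_eq_zero, not_le]; positivity
  have hsub : (t • a +ᵥ (1 - t) • (K ∩ -L)) ⊆ K ∩ ({t • (a - l)} - L) := by
    rintro _ ⟨_, ⟨y, hy, rfl⟩, rfl⟩
    refine ⟨?_, mem_singleton_sub_iff.2 ?_⟩
    · exact hKc hal.1 hy.1 ht ht1'.le (by ring)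
    · convert hLc hal.2.1 hy.2 ht ht1'.le (by ring) using 1
      simp only [vadd_eq_add]
      module
  have hBc : Convex ℝ (K ∩ ({t • (a - l)} - L)) :=
    hKc.inter ((convex_singleton _).sub hLc)
  -- The inclusion `hsub` joins sets of equal volume, so it cannot be strict.
  have hBA : K ∩ ({t • (a - l)} - L) ⊆ t • a +ᵥ (1 - t) • (K ∩ -L) := by
    by_contra hnot
    refine absurd hle (not_le.2 (Convex.volume_lt_volume ?_ ?_ ?_ hBc hsub hnot))
    · exact ((hA.smul (1 - t)).vadd (t • a)).isClosed
    · rw [hvol, ← hM]; exact mul_ne_zero hpos hM0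
    · rw [hvol, ← hM]; exact ENNReal.mul_ne_top ENNReal.ofReal_ne_top hM1
  obtain ⟨_, ⟨y, hy, rfl⟩, hyp⟩ := hBA ⟨hpK, mem_singleton_sub_iff.2 (by
    rw [Set.mem_neg] at hpL
    convert hpL using 1
    module)⟩
  simp only [vadd_eq_add] at hyp
  rw [add_comm, add_left_inj] at hyp
  exact smul_right_injective _ ht1'.ne' hyp ▸ hy

theorem eq_neg_and_isFullSimplex_of_thetaConv {n : ℕ} (hn : n ≠ 0)
    {K L : Set (EuclideanSpace ℝ (Fin n))} (hK : IsCompact K) (hKc : Convex ℝ K)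
    (hL : IsCompact L) (hLc : Convex ℝ L) (hM0 : maxOverlap K L ≠ 0)
    (hM : maxOverlap K L = volume (K ∩ -L))
    (h : ∀ θ : ℝ, 0 ≤ θ → θ ≤ 1 → (1 - θ ^ (1 / (n : ℝ))) • (K + L) = thetaConv θ K L) :
    K = -L ∧ IsFullSimplex K := by
  have hexp := expansionProperty_of_thetaConv hn hK hKc hL hLc hM0 hM h
  have hint : (interior (K ∩ -L)).Nonempty :=
    (hKc.inter hLc.neg).interior_nonempty_of_volume_ne_zero (hM ▸ hM0)
  have heq : K = -L := (hexp.subset hK hKc hL.neg hLc.neg hint).antisymm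
    (hexp.symm.subset hL.neg hLc.neg hK hKc (Set.inter_comm K (-L) ▸ hint))
  rw [← heq] at hexp
  exact ⟨heq, hexp.isFullSimplex hK hKc (hint.mono (interior_mono Set.inter_subset_left))⟩

/-! ### Overlaps of a simplex in barycentric coordinates -/

theorem AffineBasis.coord_sum_smul {ι E : Type*} [Fintype ι] [AddCommGroup E] [Module ℝ E]
    (b : AffineBasis ι ℝ E) {w : ι → ℝ} (hw : ∑ i, w i = 1) (i : ι) :
    b.coord i (∑ j, w j • b j) = w i := by
  rw [← Finset.affineCombination_eq_linear_combination _ _ _ hw]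
  exact b.coord_apply_combination_of_mem (Finset.mem_univ i) hw

theorem AffineBasis.coord_sub {ι E : Type*} [AddCommGroup E] [Module ℝ E]
    (b : AffineBasis ι ℝ E) (i : ι) (y x : E) :
    b.coord i (y - x) = b.coord i y - (b.coord i).linear x := by
  have := (b.coord i).map_vadd (y - x) x
  simp only [vadd_eq_add, add_sub_cancel] at this
  linarith

theorem AffineBasis.sum_linear_coord {ι E : Type*} [Fintype ι] [AddCommGroup E] [Module ℝ E]
    (b : AffineBasis ι ℝ E) (x : E) : ∑ i, (b.coord i).linear x = 0 := by
  have h1 := b.sum_coord_apply_eq_one (0 - x)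
  simp only [b.coord_sub, Finset.sum_sub_distrib, b.sum_coord_apply_eq_one] at h1
  linarith

/-- The sum of the positive parts of the barycentric coordinates of a vector. -/
noncomputable def AffineBasis.posSum {ι E : Type*} [Fintype ι] [AddCommGroup E] [Module ℝ E]
    (b : AffineBasis ι ℝ E) (x : E) : ℝ :=
  ∑ i, max 0 ((b.coord i).linear x)

theorem AffineBasis.posSum_nonneg {ι E : Type*} [Fintype ι] [AddCommGroup E] [Module ℝ E]
    (b : AffineBasis ι ℝ E) (x : E) : 0 ≤ b.posSum x :=
  Finset.sum_nonneg fun _ _ => le_max_left _ _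

theorem AffineBasis.posSum_smul {ι E : Type*} [Fintype ι] [AddCommGroup E] [Module ℝ E]
    (b : AffineBasis ι ℝ E) {r : ℝ} (hr : 0 ≤ r) (x : E) : b.posSum (r • x) = r * b.posSum x := by
  simp only [posSum, map_smul, smul_eq_mul, Finset.mul_sum]
  exact Finset.sum_congr rfl fun i _ => by rw [mul_max_of_nonneg _ _ hr, mul_zero]

theorem AffineBasis.eq_zero_of_posSum_nonpos {ι E : Type*} [Fintype ι] [AddCommGroup E]
    [Module ℝ E] (b : AffineBasis ι ℝ E) {x : E} (h : b.posSum x ≤ 0) : x = 0 := by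
  have h0 : b.posSum x = 0 := le_antisymm h (b.posSum_nonneg x)
  have h1 := (Finset.sum_eq_zero_iff_of_nonneg fun i _ => le_max_left _ _).1 h0
  have h2 : ∀ i ∈ Finset.univ, (b.coord i).linear x ≤ 0 := fun i hi => max_eq_left_iff.1 (h1 i hi)
  have h3 := (Finset.sum_eq_zero_iff_of_nonpos h2).1 (b.sum_linear_coord x)
  have h4 : ∀ i, b.coord i (0 - x) = b.coord i 0 := fun i => by
    rw [b.coord_sub, h3 i (Finset.mem_univ i), sub_zero]
  have h5 : (0 : E) - x = 0 := b.ext_elem h4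
  simpa using h5

/-- Membership of `y` means that its `i`-th coordinate is at least `max 0 ξᵢ` for every `i`. The
slacks are nonnegative with sum `1 - posSum x`, so they are coordinates in a simplex scaled by that
factor. -/
theorem AffineBasis.convexHull_inter_sub {ι E : Type*} [Fintype ι] [AddCommGroup E] [Module ℝ E]
    (b : AffineBasis ι ℝ E) {x : E} (hx : b.posSum x ≤ 1) :
    convexHull ℝ (Set.range b) ∩ ({x} - -convexHull ℝ (Set.range b)) =
      (∑ i, max 0 ((b.coord i).linear x) • b i) +ᵥ
        (1 - b.posSum x) • convexHull ℝ (Set.range b) := by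
  rw [b.convexHull_eq_nonneg_coord]
  set ξ : ι → ℝ := fun i => (b.coord i).linear x with hξ
  set c := ∑ i, max 0 (ξ i) • b i with hc
  have hsum : ∑ i, max 0 (ξ i) = b.posSum x := rfl
  have hsx := b.sum_linear_coord x
  ext y
  have hmem : y ∈ ({x} - -{z | ∀ i, 0 ≤ b.coord i z} : Set E) ↔
      ∀ i, ξ i ≤ b.coord i y := by
    rw [mem_singleton_sub_iff, Set.mem_neg, neg_sub]
    simp only [Set.mem_ofPred_eq, b.coord_sub, sub_nonneg, hξ]
  rw [Set.mem_inter_iff, hmem, Set.mem_vadd_set]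
  simp only [Set.mem_smul_set, Set.mem_ofPred_eq, vadd_eq_add, exists_exists_and_eq_and]
  constructor
  · rintro ⟨h0, h1⟩
    have hle : ∀ i, 0 ≤ b.coord i y - max 0 (ξ i) := fun i => sub_nonneg.2 (max_le (h0 i) (h1 i))
    have hs : ∑ i, (b.coord i y - max 0 (ξ i)) = 1 - b.posSum x := by
      rw [Finset.sum_sub_distrib, b.sum_coord_apply_eq_one, hsum]
    have hy : ∑ i, b.coord i y • b i = y := b.linear_combination_coord_eq_self y
    rcases hx.eq_or_lt with h | h
    -- With factor zero all slacks vanish, and any point of the simplex is a witness.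
    · refine ⟨y, h0, ?_⟩
      rw [h, sub_self, zero_smul, add_zero, ← hy, hc]
      rw [h, sub_self, Finset.sum_eq_zero_iff_of_nonneg fun i _ => hle i] at hs
      exact Finset.sum_congr rfl fun i hi => by rw [sub_eq_zero.1 (hs i hi)]
    · have hpos : 0 < 1 - b.posSum x := by linarith
      refine ⟨∑ i, ((1 - b.posSum x)⁻¹ * (b.coord i y - max 0 (ξ i))) • b i, fun i => ?_, ?_⟩
      · rw [b.coord_sum_smul (by rw [← Finset.mul_sum, hs, inv_mul_cancel₀ hpos.ne'])]
        exact mul_nonneg (inv_nonneg.2 hpos.le) (hle i)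
      · simp only [mul_smul, ← Finset.smul_sum]
        rw [smul_inv_smul₀ hpos.ne', hc, ← Finset.sum_add_distrib]
        conv_rhs => rw [← hy]
        exact Finset.sum_congr rfl fun i _ => by module
  · rintro ⟨p, hp, rfl⟩
    have hco : ∀ i, b.coord i (c + (1 - b.posSum x) • p) =
        max 0 (ξ i) + (1 - b.posSum x) * b.coord i p := fun i => by
      have hsplit : c + (1 - b.posSum x) • p =
          ∑ j, (max 0 (ξ j) + (1 - b.posSum x) * b.coord j p) • b j := by
        simp only [add_smul, mul_smul, Finset.sum_add_distrib, ← Finset.smul_sum]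
        rw [b.linear_combination_coord_eq_self p]
      rw [hsplit, b.coord_sum_smul]
      rw [Finset.sum_add_distrib, ← Finset.mul_sum, b.sum_coord_apply_eq_one, hsum]
      ring
    have hge : ∀ i, max 0 (ξ i) ≤ b.coord i (c + (1 - b.posSum x) • p) := fun i => by
      rw [hco]
      have := mul_nonneg (sub_nonneg.2 hx) (hp i)
      linarith
    exact ⟨fun i => (le_max_left _ _).trans (hge i), fun i => (le_max_right _ _).trans (hge i)⟩

theorem AffineBasis.mem_convexHull_add_neg_iff {ι E : Type*} [Fintype ι] [AddCommGroup E]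
    [Module ℝ E] (b : AffineBasis ι ℝ E) {x : E} :
    x ∈ convexHull ℝ (Set.range b) + -convexHull ℝ (Set.range b) ↔ b.posSum x ≤ 1 := by
  constructor
  · rw [b.convexHull_eq_nonneg_coord]
    rintro ⟨k, hk, m, hm, rfl⟩
    rw [← b.sum_coord_apply_eq_one k]
    refine Finset.sum_le_sum fun i _ => max_le (hk i) ?_
    have h1 : b.coord i (k - (k + m)) = b.coord i k - (b.coord i).linear (k + m) := b.coord_sub ..
    have h2 : 0 ≤ b.coord i (-m) := hm i
    rw [sub_add_cancel_left] at h1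
    simp only
    linarith
  · intro hx
    obtain ⟨i⟩ := b.nonempty
    obtain ⟨p, hp⟩ : (convexHull ℝ (Set.range b) ∩
        ({x} - -convexHull ℝ (Set.range b))).Nonempty := by
      rw [b.convexHull_inter_sub hx]
      exact Set.Nonempty.vadd_set (Set.Nonempty.smul_set
        ⟨b i, subset_convexHull ℝ _ (Set.mem_range_self i)⟩)
    exact ⟨p, hp.1, x - p, mem_singleton_sub_iff.1 hp.2, by simp⟩

theorem AffineBasis.mem_smul_convexHull_add_neg_iff {ι E : Type*} [Fintype ι] [AddCommGroup E]
    [Module ℝ E] (b : AffineBasis ι ℝ E) {x : E} {r : ℝ} (hr : 0 ≤ r) :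
    x ∈ r • (convexHull ℝ (Set.range b) + -convexHull ℝ (Set.range b)) ↔ b.posSum x ≤ r := by
  constructor
  · rintro ⟨z, hz, rfl⟩
    simp only
    rw [b.posSum_smul hr]
    exact mul_le_of_le_one_right hr (b.mem_convexHull_add_neg_iff.1 hz)
  · intro hx
    rcases hr.eq_or_lt with rfl | hr
    · rw [b.eq_zero_of_posSum_nonpos hx]
      refine ⟨0, b.mem_convexHull_add_neg_iff.2 ?_, by simp⟩
      simp [posSum]
    · rw [Set.mem_smul_set_iff_inv_smul_mem₀ hr.ne', b.mem_convexHull_add_neg_iff,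
        b.posSum_smul (inv_nonneg.2 hr.le), inv_mul_le_iff₀ hr, mul_one]
      exact hx

theorem IsFullSimplex.exists_affineBasis {n : ℕ} {S : Set (EuclideanSpace ℝ (Fin n))}
    (h : IsFullSimplex S) :
    ∃ b : AffineBasis (Fin (n + 1)) ℝ (EuclideanSpace ℝ (Fin n)),
      S = convexHull ℝ (Set.range b) := by
  obtain ⟨s, hs⟩ := h
  refine ⟨⟨s.points, s.independent, ?_⟩, hs⟩
  exact s.independent.affineSpan_eq_top_iff_card_eq_finrank_add_one.2 (by simp)

theorem smul_add_neg_eq_thetaConv {n : ℕ} (hn : n ≠ 0) {K : Set (EuclideanSpace ℝ (Fin n))}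
    (hK : IsFullSimplex K) (hM : maxOverlap K (-K) = volume K) (hM0 : volume K ≠ 0)
    (hM1 : volume K ≠ ∞) {θ : ℝ} (h0 : 0 ≤ θ) (h1 : θ ≤ 1) :
    (1 - θ ^ (1 / (n : ℝ))) • (K + -K) = thetaConv θ K (-K) := by
  obtain ⟨b, rfl⟩ := hK.exists_affineBasis
  have hroot0 : 0 ≤ θ ^ (1 / (n : ℝ)) := Real.rpow_nonneg h0 _
  have hroot1 : θ ^ (1 / (n : ℝ)) ≤ 1 := Real.rpow_le_one h0 h1 (by positivity)
  ext x
  rw [b.mem_smul_convexHull_add_neg_iff (sub_nonneg.2 hroot1), thetaConv, Set.mem_ofPred_eq,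
    b.mem_convexHull_add_neg_iff, hM]
  have key : b.posSum x ≤ 1 → (ENNReal.ofReal θ * volume (convexHull ℝ (Set.range b)) ≤
      volume (convexHull ℝ (Set.range b) ∩ ({x} - -convexHull ℝ (Set.range b))) ↔
      b.posSum x ≤ 1 - θ ^ (1 / (n : ℝ))) := by
    intro hx
    have hx' : 0 ≤ 1 - b.posSum x := sub_nonneg.2 hx
    rw [b.convexHull_inter_sub hx, volume_vadd_smul _ hx', ENNReal.mul_le_mul_iff_left hM0 hM1,
      ENNReal.ofReal_le_ofReal_iff (by positivity), le_sub_comm, one_div,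
      Real.rpow_inv_le_iff_of_pos h0 hx' (by positivity), Real.rpow_natCast]
  constructor
  · intro hx
    have hx1 : b.posSum x ≤ 1 := by linarith
    exact ⟨hx1, (key hx1).2 hx⟩
  · exact fun hx => (key hx.1).1 hx.2

/-! ### The equivalence -/

theorem mainTheorem6 (n : ℕ) (hn : 1 ≤ n)
    (K L : ConvexBody (EuclideanSpace ℝ (Fin n)))
    (hK : (interior (K : Set (EuclideanSpace ℝ (Fin n)))).Nonempty)
    (hL : (interior (L : Set (EuclideanSpace ℝ (Fin n)))).Nonempty)
    (hM : maxOverlap (K : Set (EuclideanSpace ℝ (Fin n))) (L : Set (EuclideanSpace ℝ (Fin n))) =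
      volume ((K : Set (EuclideanSpace ℝ (Fin n))) ∩ -(L : Set (EuclideanSpace ℝ (Fin n))))) :
    List.TFAE [
      ∀ θ₀ θ : ℝ, 0 ≤ θ₀ → θ₀ ≤ θ → θ ≤ 1 →
        (1 - θ ^ (1 / (n : ℝ))) •
            thetaConv θ₀ (K : Set (EuclideanSpace ℝ (Fin n)))
              (L : Set (EuclideanSpace ℝ (Fin n))) =
          (1 - θ₀ ^ (1 / (n : ℝ))) •
            thetaConv θ (K : Set (EuclideanSpace ℝ (Fin n)))
              (L : Set (EuclideanSpace ℝ (Fin n))),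
      ∀ θ : ℝ, 0 ≤ θ → θ ≤ 1 →
        (1 - θ ^ (1 / (n : ℝ))) •
            ((K : Set (EuclideanSpace ℝ (Fin n))) + (L : Set (EuclideanSpace ℝ (Fin n)))) =
          thetaConv θ (K : Set (EuclideanSpace ℝ (Fin n)))
            (L : Set (EuclideanSpace ℝ (Fin n))),
      (K : Set (EuclideanSpace ℝ (Fin n))) = -(L : Set (EuclideanSpace ℝ (Fin n))) ∧
        IsFullSimplex (K : Set (EuclideanSpace ℝ (Fin n)))] := by

  have hn0 : n ≠ 0 := by omega
  have hM0 := maxOverlap_ne_zero hK hL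
  -- Needs `n ≥ 1`: a zero exponent would give `1`. It makes (ii) the case `θ₀ = 0` of (i).
  have h0 : (0 : ℝ) ^ (1 / (n : ℝ)) = 0 := Real.zero_rpow (by positivity)
  tfae_have 1 → 2 := by
    intro h θ hθ0 hθ1
    have hzero : thetaConv 0 (K : Set (EuclideanSpace ℝ (Fin n))) L = K + L := by
      ext x
      simp [thetaConv]
    have := h 0 θ le_rfl hθ0 hθ1
    rwa [h0, sub_zero, one_smul, hzero] at this
  tfae_have 2 → 1 := by
    intro h θ₀ θ hθ₀ hθ hθ1
    rw [← h θ₀ hθ₀ (hθ.trans hθ1), ← h θ (hθ₀.trans hθ) hθ1, smul_comm]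
  tfae_have 2 → 3 := eq_neg_and_isFullSimplex_of_thetaConv hn0 K.isCompact K.convex
    L.isCompact L.convex hM0 hM
  tfae_have 3 → 2 := by
    rintro ⟨hKL, hS⟩ θ hθ0 hθ1
    have hLK : (L : Set (EuclideanSpace ℝ (Fin n))) = -K := by rw [hKL, neg_neg]
    rw [hLK, neg_neg, Set.inter_self] at hM
    rw [hLK] at hM0 ⊢
    exact smul_add_neg_eq_thetaConv hn0 hS hM (hM ▸ hM0) K.isCompact.measure_lt_top.ne hθ0 hθ1
  tfae_finish
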